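/- For every $n\ge 1$ let $w^{(n)}=(w_1,\dots,w_n)$ be a vector of positive reals with $\max_i w_i^2\le\sum_k w_k$, and let $\mathcal G(w^{(n)})$ be the Chung--Lu random graph on $n$ vertices: independently over unordered pairs of vertices, $i$ and $j$ are joined with probability $p_{ij}=w_iw_j/\sum_k w_k$. (Pairs $i=j$ may be included, a loop then contributing $1$ to the degree, or excluded; the statement holds for both versions.) Let $\mathbf A$ be the adjacency matrix of the graph, $\mathbf d=\mathbf A\mathbf 1$, $\mathbf D=\mathrm{diag}(\mathbf d)$, $\mathbf P=\mathbf A\mathbf D^{-1}$ and $\mathrm{vol}(G)=\sum_i d_i$. Let $\alpha\in(0,1)$ be fixed and let $\mathbf v=\mathbf v^{(n)}$ be (deterministic) probability vectors of length $n$ with $\|\mathbf v^{(n)}\|_2=O(1/\sqrt n)$. The PageRank vector $\boldsymbol\pi=\boldsymbol\pi^{(n)}$ is the stationary probability distribution of the transition matrix $\alpha\mathbf P+(1-\alpha)\mathbf v\mathbf 1^T$, i.e. the probability vector with $(\alpha\mathbf P+(1-\alpha)\mathbf v\mathbf 1^T)\boldsymbol\pi=\boldsymbol\pi$. Put $$\overline{\boldsymbol\pi}^{(n)}=\alpha\,\frac{\mathbf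 d}{\mathrm{vol}(G)}+(1-\alpha)\mathbf v .$$ Suppose that $\overline w=\frac1n\sum_k w_k\gg\log^6 n$, i.e. $\log^6(n)=o(\overline w)$, and that $w_{\max}\le K\,w_{\min}$ for some constant $K$ that does not depend on $n$. Then with high probability $$d_{\mathrm{TV}}\bigl(\boldsymbol\pi^{(n)},\overline{\boldsymbol\pi}^{(n)}\bigr)=\tfrac12\sum_i\bigl|\pi_i-\overline\pi_i\bigr|=o(1).$$ Explicitly: there are a deterministic sequence $\psi(n)\to0$ and constants $c>0$, $C$, $N$ such that for all $n>N$, with probability at least $1-Cn^{-c}$, the graph has no isolated vertex (all $d_i>0$), the PageRank vector $\boldsymbol\pi^{(n)}$ exists and is unique, and $d_{\mathrm{TV}}(\boldsymbol\pi^{(n)},\overline{\boldsymbol\pi}^{(n)})\le\psi(n)$. The same conclusion holds for Erdős--Rényi graphs $\mathcal G(n,p_n)$, $p_n\in[0,1]$, whenever $np_n\gg\log^6 n$. -/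

import Mathlib

open MeasureTheory ProbabilityTheory Filter Topology Asymptotics Matrix
open scoped unitInterval

noncomputable section

namespace PageRankTV

/-! ### PageRank of an undirected graph, given by its adjacency matrix -/

section PageRank

variable {V : Type*} [Fintype V] [DecidableEq V]

/-- The vector of degrees `d = A 1`. -/
def degree (A : Matrix V V ℝ) : V → ℝ := A *ᵥ 1

/-- The volume `∑ i, d i`. -/
def vol (A : Matrix V V ℝ) : ℝ := ∑ i, degree A i

/-- The transition matrix `P = A D⁻¹`, `D = diag d`, of the simple random walk. It is
column-stochastic as soon as all degrees are positive. -/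
def transition (A : Matrix V V ℝ) : Matrix V V ℝ :=
  A * diagonal (fun i => (degree A i)⁻¹)

/-- The transition matrix `α P + (1 - α) v 1ᵀ` of the walk with restart. -/
def restartTransition (A : Matrix V V ℝ) (α : ℝ) (v : V → ℝ) : Matrix V V ℝ :=
  α • transition A + (1 - α) • vecMulVec v 1

/-- `π` is a personalized PageRank vector with damping factor `α` and preference vector `v`:
a stationary probability distribution of the walk with restart. -/
def IsPageRank (A : Matrix V V ℝ) (α : ℝ) (v π : V → ℝ) : Prop :=
  π ∈ stdSimplex ℝ V ∧ restartTransition A α v *ᵥ π = π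

/-- The mixture `α d / vol(G) + (1 - α) v`. -/
def mixture (A : Matrix V V ℝ) (α : ℝ) (v : V → ℝ) : V → ℝ :=
  fun i => α * (degree A i / vol A) + (1 - α) * v i

/-- Total variation distance of two discrete distributions. -/
def tvDist (x y : V → ℝ) : ℝ := (1 / 2) * ∑ i, |x i - y i|

end PageRank

/-! ### Events that hold with high probability -/

/-- The events `E n` hold with high probability: `ℙ(E n) ≥ 1 - O(n ^ (-c))` for some `c > 0`. -/
def WithHighProb {Ω : ℕ → Type*} [∀ n, MeasurableSpace (Ω n)] (μ : ∀ n, Measure (Ω n))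
    (E : ∀ n, Set (Ω n)) : Prop :=
  ∃ c : ℝ, 0 < c ∧ ∃ (C : ℝ) (N : ℕ), ∀ n : ℕ, N < n →
    1 - C * (n : ℝ) ^ (-c) ≤ (μ n).real (E n)

/-- For random graphs on `n` vertices with law `μ n` and adjacency matrix `A n`: there is a
deterministic sequence `ψ n → 0` such that with high probability the graph has no isolated vertex
(so that the random walk makes sense), PageRank exists and is unique, and PageRank is within `ψ n`
of the mixture `α d / vol(G) + (1 - α) v` in total variation. -/
def PageRankApproxWHP {Ω : ℕ → Type*} [∀ n, MeasurableSpace (Ω n)] (μ : ∀ n, Measure (Ω n))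
    (A : ∀ n, Ω n → Matrix (Fin n) (Fin n) ℝ) (α : ℝ) (v : ∀ n, Fin n → ℝ) : Prop :=
  ∃ ψ : ℕ → ℝ, Tendsto ψ atTop (𝓝 0) ∧
    WithHighProb μ (fun n => {ω | (∀ i, 0 < degree (A n ω) i) ∧
      (∃! π, IsPageRank (A n ω) α (v n) π) ∧
      ∀ π, IsPageRank (A n ω) α (v n) π →
        tvDist π (mixture (A n ω) α (v n)) ≤ ψ n})

/-! ### Random graphs -/

section Graphs

variable {n : ℕ}

/-- The Chung-Lu edge probability `w i * w j / ∑ k, w k` of the unordered pair `s(i, j)`.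
The projection to `[0, 1]` does nothing if `w` is positive and `w i ^ 2 ≤ ∑ k, w k` for all `i`:
see `chungLuProb_eq`. -/
def chungLuProb (w : Fin n → ℝ) : Sym2 (Fin n) → I :=
  Sym2.lift ⟨fun i j => Set.projIcc 0 1 zero_le_one (w i * w j / ∑ k, w k),
    fun i j => by simp only [mul_comm]⟩

theorem chungLuProb_eq (w : Fin n → ℝ) (hpos : ∀ i, 0 < w i)
    (hw : ∀ i, w i ^ 2 ≤ ∑ k, w k) (i j : Fin n) :
    (chungLuProb w s(i, j) : ℝ) = w i * w j / ∑ k, w k := by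
  have hS : 0 < ∑ k, w k := lt_of_lt_of_le (pow_pos (hpos i) 2) (hw i)
  have h0 : 0 ≤ w i * w j / ∑ k, w k :=
    div_nonneg (mul_nonneg (hpos i).le (hpos j).le) hS.le
  have h1 : w i * w j / ∑ k, w k ≤ 1 := by
    rw [div_le_one hS]
    nlinarith [hw i, hw j, sq_nonneg (w i - w j)]
  simp [chungLuProb, Set.coe_projIcc, h0, h1]

/-- The law of the edge indicators of the Chung-Lu graph: independent Bernoulli variables, one for
each unordered pair of (possibly equal) vertices. -/
def chungLuMeasure (w : Fin n → ℝ) : Measure (Sym2 (Fin n) → Bool) :=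
  Measure.pi (fun e => bernoulliMeasure true false (chungLuProb w e))

instance (w : Fin n → ℝ) : IsProbabilityMeasure (chungLuMeasure w) := by
  unfold chungLuMeasure; infer_instance

/-- The adjacency matrix of the graph with edge indicators `ω`, loops included. A loop counts once
in the degree of its vertex, so that `w` is exactly the vector of expected degrees. -/
def adjLoops (ω : Sym2 (Fin n) → Bool) : Matrix (Fin n) (Fin n) ℝ :=
  Matrix.of fun i j => if ω s(i, j) = true then 1 else 0

/-- The adjacency matrix of the simple graph with edge indicators `ω`, loops discarded. -/
def adjSimple (ω : Sym2 (Fin n) → Bool) : Matrix (Fin n) (Fin n) ℝ :=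
  Matrix.of fun i j => if i ≠ j ∧ ω s(i, j) = true then 1 else 0

open Classical in
/-- The adjacency matrix of a simple graph. -/
def adjGraph (G : SimpleGraph (Fin n)) : Matrix (Fin n) (Fin n) ℝ := G.adjMatrix ℝ

end Graphs

end PageRankTV

end

/-! Write `P` for the walk's transition matrix and `u = d / vol`. Since `π = α P π + (1 - α) v`, the
difference between `π` and the mixture is `α η` with `η = P π - u`. As `P u = u`, this `η` satisfies
`η = α P η + (1 - α) (P v - u)`, and `P` does not increase the `ℓ¹` norm, so `‖η‖₁ ≤ ‖P v - u‖₁`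
(`tvDist_mixture_le`). No spectral gap is needed: it suffices that a single step from the fixed
vector `v` nearly mixes.

To see this, split `v = x + y` by truncating at `L / n`. The bound on `‖v‖₂` makes the mass of `y`
at most of order `1 / L`. All degrees are within a factor `1 ± ε` of the weights `w` by a Chernoff
bound, so `P x` is close to `A (x / w)`, whose mean is, up to loops, `(∑ x) w / ∑ w`, and this is
close to `(∑ x) u` (`sum_abs_transition_mulVec_sub_le`). What remains is `‖(A - 𝔼 A) (x / w)‖₁`. It
is a maximum of `2 ^ n` bilinear forms, one per sign vector; each has a Chernoff tail `exp (-2n)`,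
which survives the union bound (`chungLu_l1_tail`).

With `W` a lower bound for the weights, the choice `ε = W ^ (-1/4)`, `L = W ^ (1/2)` sends every
error to zero. The Erdős–Rényi graph is the loopless case with constant weights. -/

namespace PageRankTV

/-! ### Deterministic `ℓ¹` estimates for PageRank -/

section Deterministic

variable {V : Type*} [Fintype V] {A : Matrix V V ℝ}

theorem degree_apply (A : Matrix V V ℝ) (i : V) : degree A i = ∑ j, A i j := by
  simp [degree, mulVec, dotProduct]

theorem sum_mulVec (hs : ∀ i j, A i j = A j i) (x : V → ℝ) :
    ∑ i, (A *ᵥ x) i = ∑ j, degree A j * x j := by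
  simp only [mulVec, dotProduct, degree_apply]
  rw [Finset.sum_comm]
  refine Finset.sum_congr rfl fun j _ => ?_
  rw [Finset.sum_mul]
  exact Finset.sum_congr rfl fun i _ => by rw [hs i j]

theorem sum_abs_mulVec_le (hs : ∀ i j, A i j = A j i) (h0 : ∀ i j, 0 ≤ A i j) (x : V → ℝ) :
    ∑ i, |(A *ᵥ x) i| ≤ ∑ j, degree A j * |x j| := by
  rw [← sum_mulVec hs fun j => |x j|]
  refine Finset.sum_le_sum fun i _ => ?_
  simp only [mulVec, dotProduct]
  refine (Finset.abs_sum_le_sum_abs _ _).trans (Finset.sum_le_sum fun j _ => ?_)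
  rw [abs_mul, abs_of_nonneg (h0 i j)]

theorem eq_zero_of_sum_abs_le_mul {α : ℝ} (hα : α < 1) {x : V → ℝ}
    (h : ∑ i, |x i| ≤ α * ∑ i, |x i|) : x = 0 := by
  have h0 : 0 ≤ ∑ i, |x i| := Finset.sum_nonneg fun i _ => abs_nonneg _
  have h1 : ∑ i, |x i| = 0 := by nlinarith
  ext i
  exact abs_eq_zero.1 ((Finset.sum_eq_zero_iff_of_nonneg fun i _ => abs_nonneg _).1 h1 i
    (Finset.mem_univ i))

/-- The numerators and the normalising constants each contribute a total error `ε`. -/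
theorem sum_abs_degree_div_vol_sub_le [Nonempty V] (hd : ∀ i, 0 < degree A i) {w : V → ℝ}
    (hw : ∀ i, 0 < w i) {ε : ℝ} (hε : ∀ i, |degree A i - w i| ≤ ε * w i) :
    ∑ i, |degree A i / vol A - w i / ∑ k, w k| ≤ 2 * ε := by
  have hS : 0 < ∑ k, w k := Finset.sum_pos (fun i _ => hw i) Finset.univ_nonempty
  have hV : 0 < vol A := Finset.sum_pos (fun i _ => hd i) Finset.univ_nonempty
  have hsum : ∑ i, |degree A i - w i| ≤ ε * ∑ k, w k := by
    rw [Finset.mul_sum]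
    exact Finset.sum_le_sum fun i _ => hε i
  have hvol : |∑ k, w k - vol A| ≤ ε * ∑ k, w k := by
    refine le_trans ?_ hsum
    rw [abs_sub_comm, vol, ← Finset.sum_sub_distrib]
    exact Finset.abs_sum_le_sum_abs _ _
  have hi : ∀ i, |degree A i / vol A - w i / ∑ k, w k|
      ≤ degree A i * (|∑ k, w k - vol A| / (vol A * ∑ k, w k))
        + |degree A i - w i| / ∑ k, w k := fun i => by
    have : degree A i / vol A - w i / ∑ k, w k
        = degree A i * ((∑ k, w k - vol A) / (vol A * ∑ k, w k))
          + (degree A i - w i) / ∑ k, w k := by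
      field_simp
      ring
    rw [this]
    refine (abs_add_le _ _).trans (le_of_eq ?_)
    rw [abs_mul, abs_div, abs_div, abs_of_pos (hd i), abs_of_pos hS, abs_of_pos (mul_pos hV hS)]
  calc _ ≤ ∑ i, (degree A i * (|∑ k, w k - vol A| / (vol A * ∑ k, w k))
        + |degree A i - w i| / ∑ k, w k) := Finset.sum_le_sum fun i _ => hi i
    _ = |∑ k, w k - vol A| / ∑ k, w k + (∑ i, |degree A i - w i|) / ∑ k, w k := by
      rw [Finset.sum_add_distrib, ← Finset.sum_mul, ← Finset.sum_div]
      change vol A * _ + _ = _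
      congr 1
      field_simp
    _ ≤ ε + ε := add_le_add ((div_le_iff₀ hS).2 hvol) ((div_le_iff₀ hS).2 hsum)
    _ = 2 * ε := by ring

variable [DecidableEq V]

theorem transition_mulVec (A : Matrix V V ℝ) (x : V → ℝ) :
    transition A *ᵥ x = A *ᵥ fun j => x j / degree A j := by
  rw [transition, ← mulVec_mulVec]
  congr 1
  ext j
  rw [mulVec_diagonal, div_eq_inv_mul]

theorem sum_transition_mulVec (hs : ∀ i j, A i j = A j i) (hd : ∀ i, 0 < degree A i)
    (x : V → ℝ) : ∑ i, (transition A *ᵥ x) i = ∑ i, x i := by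
  rw [transition_mulVec, sum_mulVec hs]
  exact Finset.sum_congr rfl fun j _ => mul_div_cancel₀ _ (hd j).ne'

/-- The transition matrix of the random walk is a contraction of `ℓ¹`. -/
theorem sum_abs_transition_mulVec_le (hs : ∀ i j, A i j = A j i) (h0 : ∀ i j, 0 ≤ A i j)
    (hd : ∀ i, 0 < degree A i) (x : V → ℝ) :
    ∑ i, |(transition A *ᵥ x) i| ≤ ∑ i, |x i| := by
  rw [transition_mulVec]
  refine (sum_abs_mulVec_le hs h0 _).trans (Finset.sum_le_sum fun j _ => ?_)
  rw [abs_div, abs_of_pos (hd j), mul_div_cancel₀ _ (hd j).ne']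

theorem transition_mulVec_stationary (hd : ∀ i, 0 < degree A i) :
    (transition A *ᵥ fun i => degree A i / vol A) = fun i => degree A i / vol A := by
  rw [transition_mulVec]
  ext i
  simp only [mulVec, dotProduct]
  rw [degree_apply, Finset.sum_div]
  refine Finset.sum_congr rfl fun j _ => ?_
  have := (hd j).ne'
  field_simp

theorem restartTransition_mulVec (A : Matrix V V ℝ) (α : ℝ) (v x : V → ℝ) :
    restartTransition A α v *ᵥ x
      = α • (transition A *ᵥ x) + ((1 - α) * ∑ i, x i) • v := by
  have h : vecMulVec v 1 *ᵥ x = (∑ i, x i) • v := by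
    ext i
    simp only [mulVec, dotProduct, vecMulVec_apply, Pi.one_apply, mul_one, Pi.smul_apply,
      smul_eq_mul, ← Finset.mul_sum, mul_comm]
  rw [restartTransition, add_mulVec, smul_mulVec, smul_mulVec, h, smul_smul]

theorem isPageRank_iff {α : ℝ} {v π : V → ℝ} :
    IsPageRank A α v π ↔ π ∈ stdSimplex ℝ V ∧ α • (transition A *ᵥ π) + (1 - α) • v = π := by
  refine and_congr_right fun h => ?_
  rw [restartTransition_mulVec, h.2, mul_one]

/-- Because `α < 1` and `P` contracts `ℓ¹`, the map `1 - α P` is injective, hence bijective in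
finite dimension. Its solution has total mass `1` because `P` preserves sums, and `ℓ¹` norm at most
`1` by contraction; the two together force nonnegative entries, so neither a Neumann series nor
Perron–Frobenius is needed. -/
theorem existsUnique_isPageRank (hs : ∀ i j, A i j = A j i) (h0 : ∀ i j, 0 ≤ A i j)
    (hd : ∀ i, 0 < degree A i) {α : ℝ} (hα : α ∈ Set.Ioo (0 : ℝ) 1) {v : V → ℝ}
    (hv : v ∈ stdSimplex ℝ V) : ∃! π, IsPageRank A α v π := by
  have key : ∀ x, α • (transition A *ᵥ x) = x → x = 0 := fun x hx => by
    refine eq_zero_of_sum_abs_le_mul hα.2 ?_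
    calc ∑ i, |x i| = α * ∑ i, |(transition A *ᵥ x) i| := by
          conv_lhs => rw [← hx]
          simp only [Pi.smul_apply, smul_eq_mul, abs_mul, abs_of_pos hα.1, Finset.mul_sum]
      _ ≤ _ := mul_le_mul_of_nonneg_left (sum_abs_transition_mulVec_le hs h0 hd x) hα.1.le
  let T : (V → ℝ) →ₗ[ℝ] (V → ℝ) := LinearMap.id - α • (transition A).mulVecLin
  have hT : ∀ x, T x = x - α • (transition A *ᵥ x) := fun x => rfl
  have hinj : Function.Injective T := by
    rw [← LinearMap.ker_eq_bot, LinearMap.ker_eq_bot']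
    exact fun x hx => key x (sub_eq_zero.1 ((hT x).symm.trans hx)).symm
  obtain ⟨π, hπ⟩ := LinearMap.surjective_of_injective hinj ((1 - α) • v)
  have hfix : α • (transition A *ᵥ π) + (1 - α) • v = π := by
    rw [← hπ, hT]; abel
  have hsum : ∑ i, π i = 1 := by
    have h1 : ∑ i, π i = α * ∑ i, π i + (1 - α) * ∑ i, v i := by
      conv_lhs => rw [← hfix]
      simp only [Pi.add_apply, Pi.smul_apply, smul_eq_mul, Finset.sum_add_distrib,
        ← Finset.mul_sum, sum_transition_mulVec hs hd]
    rw [hv.2] at h1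
    have : (1 - α) * (∑ i, π i - 1) = 0 := by linarith
    rcases mul_eq_zero.1 this with h | h
    · linarith [hα.2]
    · linarith
  have habs : ∑ i, |π i| ≤ 1 := by
    have h1 : ∑ i, |π i| ≤ α * ∑ i, |(transition A *ᵥ π) i| + (1 - α) * ∑ i, v i := by
      rw [Finset.mul_sum, Finset.mul_sum, ← Finset.sum_add_distrib]
      refine Finset.sum_le_sum fun i _ => ?_
      conv_lhs => rw [← hfix]
      simp only [Pi.add_apply, Pi.smul_apply, smul_eq_mul]
      refine (abs_add_le _ _).trans (le_of_eq ?_)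
      rw [abs_mul, abs_of_pos hα.1, abs_mul, abs_of_nonneg (hv.1 i),
        abs_of_pos (sub_pos.2 hα.2)]
    rw [hv.2] at h1
    have := mul_le_mul_of_nonneg_left (sum_abs_transition_mulVec_le hs h0 hd π) hα.1.le
    nlinarith [hα.2]
  have hnn : ∀ i, 0 ≤ π i := by
    have h1 : ∑ i, (|π i| - π i) = 0 := by
      refine le_antisymm ?_ (Finset.sum_nonneg fun i _ => sub_nonneg.2 (le_abs_self _))
      rw [Finset.sum_sub_distrib, hsum]
      linarith
    intro i
    have := (Finset.sum_eq_zero_iff_of_nonneg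
      fun i _ => sub_nonneg.2 (le_abs_self (π i))).1 h1 i (Finset.mem_univ i)
    exact abs_eq_self.1 (sub_eq_zero.1 this)
  refine ⟨π, isPageRank_iff.2 ⟨⟨hnn, hsum⟩, hfix⟩, fun π' hπ' => ?_⟩
  have h := (isPageRank_iff.1 hπ').2
  exact hinj (by rw [hπ, hT, sub_eq_iff_eq_add, add_comm]; exact h.symm)

/-- The distance between PageRank and the mixture is controlled by a single step of the walk. -/
theorem tvDist_mixture_le (hs : ∀ i j, A i j = A j i) (h0 : ∀ i j, 0 ≤ A i j)
    (hd : ∀ i, 0 < degree A i) {α : ℝ} (hα : α ∈ Set.Ioo (0 : ℝ) 1) {v π : V → ℝ}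
    (hπ : IsPageRank A α v π) :
    tvDist π (mixture A α v) ≤ ∑ i, |(transition A *ᵥ v) i - degree A i / vol A| := by
  have hfix := (isPageRank_iff.1 hπ).2
  set P := transition A
  set u : V → ℝ := fun i => degree A i / vol A with hu
  have hPu : P *ᵥ u = u := transition_mulVec_stationary hd
  -- Apply `P` to the fixed-point equation and subtract the stationary `u`. The contraction then
  -- absorbs the `α` term into the left side.
  have hη : P *ᵥ π - u = α • (P *ᵥ (P *ᵥ π - u)) + (1 - α) • (P *ᵥ v - u) := by
    conv_lhs => rw [← hfix]
    rw [mulVec_add, mulVec_smul, mulVec_smul, mulVec_sub, hPu]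
    ext i
    simp only [Pi.add_apply, Pi.sub_apply, Pi.smul_apply, smul_eq_mul]
    ring
  have h1 : ∑ i, |(P *ᵥ π - u) i|
      ≤ α * ∑ i, |(P *ᵥ (P *ᵥ π - u)) i| + (1 - α) * ∑ i, |(P *ᵥ v - u) i| := by
    rw [Finset.mul_sum, Finset.mul_sum, ← Finset.sum_add_distrib]
    refine Finset.sum_le_sum fun i _ => ?_
    conv_lhs => rw [hη]
    simp only [Pi.add_apply, Pi.smul_apply, smul_eq_mul]
    refine (abs_add_le _ _).trans (le_of_eq ?_)
    rw [abs_mul, abs_of_pos hα.1, abs_mul, abs_of_pos (sub_pos.2 hα.2)]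
  have h2 := mul_le_mul_of_nonneg_left
    (sum_abs_transition_mulVec_le hs h0 hd (P *ᵥ π - u)) hα.1.le
  have h3 : ∑ i, |(P *ᵥ π - u) i| ≤ ∑ i, |(P *ᵥ v - u) i| := by
    have : (1 - α) * ∑ i, |(P *ᵥ π - u) i| ≤ (1 - α) * ∑ i, |(P *ᵥ v - u) i| := by
      linarith
    exact le_of_mul_le_mul_left this (sub_pos.2 hα.2)
  have h4 : ∑ i, |π i - mixture A α v i| = α * ∑ i, |(P *ᵥ π - u) i| := by
    rw [Finset.mul_sum]
    refine Finset.sum_congr rfl fun i _ => ?_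
    rw [← abs_of_pos hα.1, ← abs_mul, abs_of_pos hα.1]
    conv_lhs => rw [← hfix]
    simp only [Pi.add_apply, Pi.sub_apply, Pi.smul_apply, smul_eq_mul, mixture, hu]
    congr 1
    ring
  have h5 : 0 ≤ ∑ i, |(P *ᵥ π - u) i| := Finset.sum_nonneg fun i _ => abs_nonneg _
  rw [tvDist, h4]
  calc 1 / 2 * (α * ∑ i, |(P *ᵥ π - u) i|) ≤ ∑ i, |(P *ᵥ π - u) i| := by nlinarith [hα.2]
    _ ≤ _ := h3

/-- One step of the walk from `x + y` is close to stationarity, if the degrees are close to `w`,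
the mass of `y` is small and `A` acts on `x / w` nearly as its expectation. -/
theorem sum_abs_transition_mulVec_sub_le [Nonempty V] (hs : ∀ i j, A i j = A j i)
    (h0 : ∀ i j, 0 ≤ A i j) (hd : ∀ i, 0 < degree A i) {w : V → ℝ} (hw : ∀ i, 0 < w i) {ε : ℝ}
    (hε : ∀ i, |degree A i - w i| ≤ ε * w i) {x y : V → ℝ} (hx : ∀ i, 0 ≤ x i)
    (hy : ∀ i, 0 ≤ y i) (hxy : ∑ i, x i + ∑ i, y i = 1) {t : ℝ}
    (ht : ∑ i, |(A *ᵥ fun j => x j / w j) i - w i / (∑ k, w k) * ∑ j, x j| ≤ t) :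
    ∑ i, |(transition A *ᵥ (x + y)) i - degree A i / vol A| ≤ 2 * ∑ i, y i + 3 * ε + t := by
  have hS : 0 < ∑ k, w k := Finset.sum_pos (fun i _ => hw i) Finset.univ_nonempty
  have hε0 : 0 ≤ ε := by
    obtain ⟨i⟩ := ‹Nonempty V›
    have := (abs_nonneg _).trans (hε i)
    exact nonneg_of_mul_nonneg_left this (hw i)
  have hY : ∑ i, |(transition A *ᵥ y) i| ≤ ∑ i, y i := by
    refine (sum_abs_transition_mulVec_le hs h0 hd y).trans (le_of_eq ?_)
    exact Finset.sum_congr rfl fun i _ => abs_of_nonneg (hy i)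
  -- Cost of replacing the random degrees by the deterministic weights: column `j` of `A` has sum
  -- `degree A j`, which cancels the denominator and leaves the relative error of the degree.
  have hX : ∑ i, |(A *ᵥ fun j => x j / degree A j - x j / w j) i| ≤ ε := by
    refine (sum_abs_mulVec_le hs h0 _).trans ?_
    calc _ ≤ ∑ j, ε * x j := Finset.sum_le_sum fun j _ => by
          have h1 : x j / degree A j - x j / w j
              = x j * ((w j - degree A j) / (degree A j * w j)) := by
            have := (hd j).ne'
            have := (hw j).ne'
            field_simp
          rw [h1, abs_mul, abs_of_nonneg (hx j), abs_div, abs_of_pos (mul_pos (hd j) (hw j)),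
            abs_sub_comm]
          have h2 : degree A j * (x j * (|degree A j - w j| / (degree A j * w j)))
              = x j * (|degree A j - w j| / w j) := by
            have := (hd j).ne'
            have := (hw j).ne'
            field_simp
          rw [h2, mul_comm ε]
          exact mul_le_mul_of_nonneg_left ((div_le_iff₀ (hw j)).2 (hε j)) (hx j)
      _ = ε * ∑ j, x j := (Finset.mul_sum _ _ _).symm
      _ ≤ ε * 1 := mul_le_mul_of_nonneg_left
          (by linarith [Finset.sum_nonneg fun i (_ : i ∈ Finset.univ) => hy i]) hε0
      _ = ε := mul_one _
  have hZ : ∑ i, |w i / (∑ k, w k) * ∑ j, y j| = ∑ j, y j := by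
    rw [Finset.sum_congr rfl fun i _ => abs_of_nonneg (mul_nonneg (div_nonneg (hw i).le hS.le)
      (Finset.sum_nonneg fun i _ => hy i)), ← Finset.sum_mul, ← Finset.sum_div, div_self hS.ne',
      one_mul]
  have hU := sum_abs_degree_div_vol_sub_le hd hw hε
  have hi : ∀ i, |(transition A *ᵥ (x + y)) i - degree A i / vol A|
      ≤ |(transition A *ᵥ y) i| + |(A *ᵥ fun j => x j / degree A j - x j / w j) i|
        + |(A *ᵥ fun j => x j / w j) i - w i / (∑ k, w k) * ∑ j, x j|
        + |w i / (∑ k, w k) * ∑ j, y j| + |degree A i / vol A - w i / ∑ k, w k| := fun i => by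
    have e1 : (A *ᵥ fun j => x j / degree A j - x j / w j) i
        = (transition A *ᵥ x) i - (A *ᵥ fun j => x j / w j) i := by
      rw [transition_mulVec, ← Pi.sub_apply, ← mulVec_sub]
      rfl
    have e2 : ∑ j, x j = 1 - ∑ j, y j := by linarith
    have e3 : (transition A *ᵥ (x + y)) i - degree A i / vol A
        = (transition A *ᵥ y) i + (A *ᵥ fun j => x j / degree A j - x j / w j) i
        + ((A *ᵥ fun j => x j / w j) i - w i / (∑ k, w k) * ∑ j, x j)
        - w i / (∑ k, w k) * ∑ j, y j - (degree A i / vol A - w i / ∑ k, w k) := by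
      rw [e1, mulVec_add, Pi.add_apply, e2]
      ring
    rw [e3]
    refine (abs_sub _ _).trans (add_le_add_left ((abs_sub _ _).trans (add_le_add_left
      ((abs_add_le _ _).trans (add_le_add_left (abs_add_le _ _) _)) _)) _)
  refine (Finset.sum_le_sum fun i _ => hi i).trans ?_
  simp only [Finset.sum_add_distrib]
  linarith

end Deterministic

end PageRankTV

namespace PageRankTV

/-! ### Chernoff bound for weighted sums of independent Bernoulli variables -/

section Chernoff

variable {ι : Type*} [Fintype ι]

/-- The law of independent Bernoulli variables with success probabilities `q`. -/
noncomputable abbrev bernoulliPi (q : ι → I) : Measure (ι → Bool) :=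
  Measure.pi fun e => bernoulliMeasure true false (q e)

/-- The indicator of `true`, as a real number. -/
noncomputable def boolInd (b : Bool) : ℝ := if b = true then 1 else 0

/-- Uses `exp y ≤ 1 + y + y ^ 2` for `|y| ≤ 1`, then `1 + z ≤ exp z`; the linear term cancels
against the centering. -/
theorem integral_exp_centered_bernoulli_le (p : I) {y : ℝ} (hy : |y| ≤ 1) :
    ∫ b, Real.exp (y * (boolInd b - p)) ∂(bernoulliMeasure true false p)
      ≤ Real.exp (p * y ^ 2) := by
  have hp := p.2.1
  rw [integral_bernoulliMeasure]
  simp only [boolInd, smul_eq_mul, if_true, Bool.false_eq_true, if_false]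
  have h1 := (abs_le.1 (Real.abs_exp_sub_one_sub_id_le hy)).2
  have e1 : Real.exp (y * (1 - (p : ℝ))) = Real.exp (-(y * p)) * Real.exp y := by
    rw [← Real.exp_add]; ring_nf
  have e2 : Real.exp (y * (0 - (p : ℝ))) = Real.exp (-(y * p)) := by ring_nf
  calc _ = Real.exp (-(y * p)) * (p * (Real.exp y - 1) + 1) := by rw [e1, e2]; ring
    _ ≤ Real.exp (-(y * p)) * Real.exp (p * (y + y ^ 2)) := by
      refine mul_le_mul_of_nonneg_left ?_ (Real.exp_pos _).le
      refine le_trans ?_ (Real.add_one_le_exp _)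
      have := mul_le_mul_of_nonneg_left (show Real.exp y - 1 ≤ y + y ^ 2 by linarith) hp
      linarith
    _ = _ := by rw [← Real.exp_add]; ring_nf

/-- The Chernoff bound for a linear combination of independent Bernoulli variables. -/
theorem bernoulliPi_real_ge_le (q : ι → I) (c : ι → ℝ) {l : ℝ} (hl : 0 ≤ l)
    (hc : ∀ e, |l * c e| ≤ 1) (t : ℝ) :
    (bernoulliPi q).real {ω | t ≤ ∑ e, c e * (boolInd (ω e) - q e)}
      ≤ Real.exp (-(l * t) + l ^ 2 * ∑ e, q e * c e ^ 2) := by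
  have hmgf : mgf (fun ω : ι → Bool => ∑ e, c e * (boolInd (ω e) - q e)) (bernoulliPi q) l
      ≤ Real.exp (l ^ 2 * ∑ e, q e * c e ^ 2) := by
    have h1 : ∀ ω : ι → Bool, Real.exp (l * ∑ e, c e * (boolInd (ω e) - q e))
        = ∏ e, Real.exp (l * c e * (boolInd (ω e) - q e)) := fun ω => by
      rw [← Real.exp_sum, Finset.mul_sum]
      simp only [mul_assoc]
    simp only [mgf, h1]
    rw [integral_fintype_prod_eq_prod (fun e b => Real.exp (l * c e * (boolInd b - q e))),
      Finset.mul_sum, Real.exp_sum]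
    refine Finset.prod_le_prod (fun e _ => integral_nonneg fun b => (Real.exp_pos _).le)
      fun e _ => (integral_exp_centered_bernoulli_le (q e) (hc e)).trans (le_of_eq ?_)
    ring_nf
  calc _ ≤ Real.exp (-l * t) * mgf (fun ω : ι → Bool => ∑ e, c e * (boolInd (ω e) - q e))
        (bernoulliPi q) l := measure_ge_le_exp_mul_mgf t hl Integrable.of_finite
    _ ≤ Real.exp (-l * t) * Real.exp (l ^ 2 * ∑ e, q e * c e ^ 2) :=
      mul_le_mul_of_nonneg_left hmgf (Real.exp_pos _).le
    _ = _ := by rw [← Real.exp_add, neg_mul]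

end Chernoff

/-! ### Bilinear forms in symmetric Bernoulli matrices -/

section Symmetric

variable {V : Type*} [Fintype V] [DecidableEq V]

theorem card_filter_mk_eq_le (e : Sym2 V) :
    (Finset.univ.filter fun a : V × V => s(a.1, a.2) = e).card ≤ 2 := by
  induction e using Sym2.ind with
  | _ x y =>
    refine (Finset.card_le_card (t := {(x, y), (y, x)}) fun a ha => ?_).trans Finset.card_le_two
    rcases Sym2.eq_iff.1 (Finset.mem_filter.1 ha).2 with h | h
    · simp [Prod.ext_iff, h.1, h.2]
    · simp [Prod.ext_iff, h.1, h.2]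

/-- Independence holds over unordered pairs only, so the coefficients of `(i, j)` and `(j, i)` must
be merged before a Chernoff bound applies. -/
theorem sum_mk_eq (f : V → V → ℝ) (g : Sym2 V → ℝ) :
    ∑ i, ∑ j, f i j * g s(i, j)
      = ∑ e, (∑ a : V × V with s(a.1, a.2) = e, f a.1 a.2) * g e := by
  rw [← Finset.sum_product', Finset.univ_product_univ,
    ← Finset.sum_fiberwise Finset.univ fun a : V × V => s(a.1, a.2)]
  refine Finset.sum_congr rfl fun e _ => ?_
  rw [Finset.sum_mul]
  exact Finset.sum_congr rfl fun a ha => by rw [(Finset.mem_filter.1 ha).2]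

/-- The Chernoff bound for a bilinear form in a random symmetric Bernoulli matrix. -/
theorem bernoulliPi_real_bilin_ge_le (q : Sym2 V → I) (f : V → V → ℝ) {B l : ℝ} (hl : 0 ≤ l)
    (hf : ∀ i j, |f i j| ≤ B) (hB : 2 * (l * B) ≤ 1) (t : ℝ) :
    (bernoulliPi q).real
        {ω | t ≤ ∑ i, ∑ j, f i j * (boolInd (ω s(i, j)) - q s(i, j))}
      ≤ Real.exp (-(l * t) + 2 * l ^ 2 * ∑ i, ∑ j, f i j ^ 2 * q s(i, j)) := by
  set c : Sym2 V → ℝ := fun e => ∑ a : V × V with s(a.1, a.2) = e, f a.1 a.2 with hcdef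
  have hc : ∀ e, |l * c e| ≤ 1 := fun e => by
    rcases isEmpty_or_nonempty V with hV | ⟨⟨x⟩⟩
    · have : c e = 0 := Finset.sum_eq_zero fun a _ => (hV.false a.1).elim
      simp [this]
    have hB0 : 0 ≤ B := (abs_nonneg _).trans (hf x x)
    have h1 : |c e| ≤ 2 * B := by
      refine (Finset.abs_sum_le_sum_abs _ _).trans
        ((Finset.sum_le_card_nsmul _ _ B fun a _ => hf _ _).trans ?_)
      rw [nsmul_eq_mul]
      exact mul_le_mul_of_nonneg_right (by exact_mod_cast card_filter_mk_eq_le e) hB0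
    rw [abs_mul, abs_of_nonneg hl]
    have := mul_le_mul_of_nonneg_left h1 hl
    linarith
  -- Cauchy–Schwarz on fibres of size at most two; this is the factor `2` in the exponent.
  have hsq : ∑ e, (q e : ℝ) * c e ^ 2 ≤ 2 * ∑ i, ∑ j, f i j ^ 2 * q s(i, j) := by
    rw [sum_mk_eq (fun i j => f i j ^ 2) fun e => (q e : ℝ), Finset.mul_sum]
    refine Finset.sum_le_sum fun e _ => ?_
    have h2 : c e ^ 2 ≤ 2 * ∑ a : V × V with s(a.1, a.2) = e, f a.1 a.2 ^ 2 :=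
      sq_sum_le_card_mul_sum_sq.trans (mul_le_mul_of_nonneg_right
        (by exact_mod_cast card_filter_mk_eq_le e) (Finset.sum_nonneg fun a _ => sq_nonneg _))
    have := mul_le_mul_of_nonneg_left h2 (q e).2.1
    linarith
  have hset : {ω : Sym2 V → Bool | t ≤ ∑ i, ∑ j, f i j * (boolInd (ω s(i, j)) - q s(i, j))}
      = {ω | t ≤ ∑ e, c e * (boolInd (ω e) - q e)} := by
    ext ω
    rw [Set.mem_ofPred_eq, Set.mem_ofPred_eq, sum_mk_eq f fun e => boolInd (ω e) - (q e : ℝ)]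
  rw [hset]
  refine (bernoulliPi_real_ge_le q c hl hc t).trans (Real.exp_le_exp.2 ?_)
  have := mul_le_mul_of_nonneg_left hsq (sq_nonneg l)
  linarith

end Symmetric

end PageRankTV

namespace PageRankTV

/-! ### Concentration for Chung–Lu graphs, with a mask for the loops -/

section ChungLu

variable {n : ℕ} {w : Fin n → ℝ}

theorem sum_chungLuProb (hpos : ∀ i, 0 < w i) (hw : ∀ i, w i ^ 2 ≤ ∑ k, w k) (i : Fin n) :
    ∑ j, (chungLuProb w s(i, j) : ℝ) = w i := by
  have hS : 0 < ∑ k, w k := lt_of_lt_of_le (pow_pos (hpos i) 2) (hw i)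
  simp only [chungLuProb_eq w hpos hw]
  rw [← Finset.sum_div, ← Finset.mul_sum, mul_div_cancel_right₀ _ hS.ne']

/-- The adjacency matrix of the graph with edge indicators `ω`, entries weighted by `χ`. -/
noncomputable def weightedAdj (χ : Sym2 (Fin n) → ℝ) (ω : Sym2 (Fin n) → Bool) :
    Matrix (Fin n) (Fin n) ℝ :=
  Matrix.of fun i j => χ s(i, j) * boolInd (ω s(i, j))

/-- The indicator functions of sets of pairs that contain all off-diagonal pairs. -/
structure IsLoopMask (χ : Sym2 (Fin n) → ℝ) : Prop where
  zero_or_one : ∀ e, χ e = 0 ∨ χ e = 1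
  eq_one : ∀ i j, i ≠ j → χ s(i, j) = 1

variable {χ : Sym2 (Fin n) → ℝ}

theorem IsLoopMask.nonneg (hχ : IsLoopMask χ) (e : Sym2 (Fin n)) : 0 ≤ χ e := by
  rcases hχ.zero_or_one e with h | h <;> norm_num [h]

theorem IsLoopMask.le_one (hχ : IsLoopMask χ) (e : Sym2 (Fin n)) : χ e ≤ 1 := by
  rcases hχ.zero_or_one e with h | h <;> norm_num [h]

theorem IsLoopMask.sq_le_one (hχ : IsLoopMask χ) (e : Sym2 (Fin n)) : χ e ^ 2 ≤ 1 := by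
  rcases hχ.zero_or_one e with h | h <;> norm_num [h]

theorem weightedAdj_symm (ω : Sym2 (Fin n) → Bool) (i j : Fin n) :
    weightedAdj χ ω i j = weightedAdj χ ω j i := by
  simp only [weightedAdj, Matrix.of_apply, Sym2.eq_swap]

theorem weightedAdj_nonneg (hχ : IsLoopMask χ) (ω : Sym2 (Fin n) → Bool) (i j : Fin n) :
    0 ≤ weightedAdj χ ω i j := by
  refine mul_nonneg (hχ.nonneg _) ?_
  unfold boolInd
  split_ifs <;> norm_num

/-- Only the diagonal term can differ, so discarding loops is a negligible perturbation of the mean.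
-/
theorem abs_sum_mask_sub_le (hχ : IsLoopMask χ) (q : Sym2 (Fin n) → I) (y : Fin n → ℝ)
    (i : Fin n) :
    |∑ j, χ s(i, j) * q s(i, j) * y j - ∑ j, q s(i, j) * y j| ≤ |y i| := by
  rw [← Finset.sum_sub_distrib, Finset.sum_eq_single i]
  · have h : χ s(i, i) * q s(i, i) * y i - q s(i, i) * y i
        = ((χ s(i, i) - 1) * q s(i, i)) * y i := by ring
    rw [h, abs_mul, abs_mul, abs_of_nonneg (q s(i, i)).2.1]
    have h1 : |χ s(i, i) - 1| ≤ 1 := by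
      rcases hχ.zero_or_one s(i, i) with h | h <;> norm_num [h]
    exact mul_le_of_le_one_left (abs_nonneg _)
      (mul_le_one₀ h1 (q s(i, i)).2.1 (q s(i, i)).2.2)
  · intro j _ hj
    rw [hχ.eq_one i j hj.symm]
    ring
  · simp

/-- The bilinear Chernoff bound for a form supported on row `i`; the signs `r = 1` and `r = -1` give
the two tails. -/
theorem chungLu_degree_tail (hpos : ∀ i, 0 < w i) (hw : ∀ i, w i ^ 2 ≤ ∑ k, w k)
    (hχ : IsLoopMask χ) {ε : ℝ} (hε0 : 0 < ε) (hε1 : ε ≤ 1) {r : ℝ} (hr : |r| = 1)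
    (i : Fin n) :
    (bernoulliPi (chungLuProb w)).real {ω | ε / 2 * w i
      ≤ r * ∑ j, χ s(i, j) * (boolInd (ω s(i, j)) - chungLuProb w s(i, j))}
      ≤ Real.exp (-(ε ^ 2 * w i / 32)) := by
  set f : Fin n → Fin n → ℝ := fun a j => if a = i then r * χ s(a, j) else 0 with hf
  have hr2 : r ^ 2 = 1 := by rw [← sq_abs, hr, one_pow]
  have hfB : ∀ a j, |f a j| ≤ 1 := fun a j => by
    simp only [hf]
    split_ifs
    · rw [abs_mul, hr, one_mul, abs_of_nonneg (hχ.nonneg _)]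
      exact hχ.le_one _
    · simp
  have hsum : ∀ g : Sym2 (Fin n) → ℝ, ∑ a, ∑ j, f a j * g s(a, j)
      = r * ∑ j, χ s(i, j) * g s(i, j) := fun g => by
    rw [Finset.sum_eq_single i (fun a _ ha => by simp [hf, ha]) (by simp), Finset.mul_sum]
    simp [hf, mul_assoc]
  have hvar : ∑ a, ∑ j, f a j ^ 2 * (chungLuProb w s(a, j) : ℝ) ≤ w i := by
    rw [Finset.sum_eq_single i (fun a _ ha => by simp [hf, ha]) (by simp),
      ← sum_chungLuProb hpos hw i]
    refine Finset.sum_le_sum fun j _ => mul_le_of_le_one_left (chungLuProb w s(i, j)).2.1 ?_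
    simp only [hf, if_true, mul_pow, hr2, one_mul]
    exact hχ.sq_le_one _
  -- With `l = ε / 8` the exponent is at most `-ε² w / 16 + ε² w / 32`.
  have h := bernoulliPi_real_bilin_ge_le (chungLuProb w) f (B := 1) (l := ε / 8) (by positivity)
    hfB (by linarith) (ε / 2 * w i)
  have hset : ∀ ω : Sym2 (Fin n) → Bool,
      ∑ a, ∑ j, f a j * (boolInd (ω s(a, j)) - chungLuProb w s(a, j))
      = r * ∑ j, χ s(i, j) * (boolInd (ω s(i, j)) - chungLuProb w s(i, j)) :=
    fun ω => hsum fun e => boolInd (ω e) - chungLuProb w e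
  simp only [hset] at h
  refine h.trans (Real.exp_le_exp.2 ?_)
  have := mul_le_mul_of_nonneg_left hvar (show 0 ≤ 2 * (ε / 8) ^ 2 by positivity)
  linarith

/-- Concentration in `ℓ¹` of the centered adjacency matrix at a fixed vector. -/
theorem chungLu_l1_tail (hpos : ∀ i, 0 < w i) (hw : ∀ i, w i ^ 2 ≤ ∑ k, w k)
    (hχ : IsLoopMask χ) (hn : 0 < n) {W L D : ℝ} (hW : 0 < W) (hL : 0 < L) {x : Fin n → ℝ}
    (hx0 : ∀ j, 0 ≤ x j) (hx : ∀ j, x j ≤ L / (n * W))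
    (hx2 : ∑ j, x j ^ 2 * w j ≤ D / (n * W)) :
    (bernoulliPi (chungLuProb w)).real {ω | D / L + 4 * L / W
      ≤ ∑ i, |∑ j, χ s(i, j) * x j * (boolInd (ω s(i, j)) - chungLuProb w s(i, j))|}
      ≤ Real.exp (-n) := by
  have hn0 : (0 : ℝ) < n := Nat.cast_pos.2 hn
  set sg : Bool → ℝ := fun b => if b = true then 1 else -1 with hsg
  have hsgabs : ∀ b, |sg b| = 1 := fun b => by cases b <;> simp [hsg]
  have hsg2 : ∀ b, sg b ^ 2 = 1 := fun b => by rw [← sq_abs, hsgabs, one_pow]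
  have hx2' : ∀ s : Fin n → Bool, ∑ i, ∑ j, (sg (s i) * χ s(i, j) * x j) ^ 2
      * (chungLuProb w s(i, j) : ℝ) ≤ D / (n * W) := fun s => by
    refine le_trans ?_ hx2
    rw [Finset.sum_comm]
    refine Finset.sum_le_sum fun j _ => ?_
    rw [← sum_chungLuProb hpos hw j, Finset.mul_sum]
    refine Finset.sum_le_sum fun i _ => ?_
    rw [mul_pow, mul_pow, hsg2, one_mul, Sym2.eq_swap]
    exact mul_le_mul_of_nonneg_right
      (mul_le_of_le_one_left (sq_nonneg _) (hχ.sq_le_one _)) (chungLuProb w _).2.1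
  have hone : ∀ s : Fin n → Bool, (bernoulliPi (chungLuProb w)).real {ω | D / L + 4 * L / W
      ≤ ∑ i, ∑ j, sg (s i) * χ s(i, j) * x j
        * (boolInd (ω s(i, j)) - chungLuProb w s(i, j))} ≤ Real.exp (-(2 * n)) := fun s => by
    -- The largest admissible `l`, with `2 * (l * B) = 1`. In the threshold, `D / L` pays exactly
    -- for the variance term and `4 * L / W` contributes the `2 * n` in the exponent.
    refine (bernoulliPi_real_bilin_ge_le (chungLuProb w) (fun i j => sg (s i) * χ s(i, j) * x j)
      (B := L / (n * W)) (l := n * W / (2 * L)) (by positivity) (fun i j => ?_) ?_ _).trans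
      (Real.exp_le_exp.2 ?_)
    · rw [abs_mul, abs_mul, hsgabs, one_mul, abs_of_nonneg (hχ.nonneg _), abs_of_nonneg (hx0 j)]
      exact (mul_le_of_le_one_left (hx0 j) (hχ.le_one _)).trans (hx j)
    · apply le_of_eq
      field_simp
    · have h1 := mul_le_mul_of_nonneg_left (hx2' s)
        (show 0 ≤ 2 * (n * W / (2 * L)) ^ 2 by positivity)
      have h2 : n * W / (2 * L) * (D / L + 4 * L / W)
          = 2 * (n * W / (2 * L)) ^ 2 * (D / (n * W)) + 2 * n := by
        field_simp
        ring
      linarith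
  have hsub : {ω : Sym2 (Fin n) → Bool | D / L + 4 * L / W
      ≤ ∑ i, |∑ j, χ s(i, j) * x j * (boolInd (ω s(i, j)) - chungLuProb w s(i, j))|}
      ⊆ ⋃ s : Fin n → Bool, {ω | D / L + 4 * L / W
      ≤ ∑ i, ∑ j, sg (s i) * χ s(i, j) * x j
        * (boolInd (ω s(i, j)) - chungLuProb w s(i, j))} := fun ω hω => by
    -- The `ℓ¹` norm is attained by pairing with the vector of signs of the coordinates.
    refine Set.mem_iUnion.2 ⟨fun i => decide (0 ≤ ∑ j, χ s(i, j) * x j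
      * (boolInd (ω s(i, j)) - chungLuProb w s(i, j))), ?_⟩
    rw [Set.mem_ofPred_eq] at hω ⊢
    refine hω.trans (Finset.sum_le_sum fun i _ => ?_)
    simp only [mul_assoc (sg _), ← Finset.mul_sum]
    by_cases h : 0 ≤ ∑ j, χ s(i, j) * x j * (boolInd (ω s(i, j)) - chungLuProb w s(i, j))
    · simp [hsg, h, abs_of_nonneg h]
    · simp [hsg, h, abs_of_neg (not_le.1 h)]
  calc _ ≤ _ := measureReal_mono hsub (measure_ne_top _ _)
    _ ≤ ∑ s : Fin n → Bool, _ := measureReal_iUnion_fintype_le _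
    _ ≤ ∑ s : Fin n → Bool, Real.exp (-(2 * n)) := Finset.sum_le_sum fun s _ => hone s
    _ = 2 ^ n * Real.exp (-(2 * n)) := by simp
    _ ≤ Real.exp n * Real.exp (-(2 * n)) := by
      refine mul_le_mul_of_nonneg_right ?_ (Real.exp_pos _).le
      rw [← mul_one (n : ℝ), Real.exp_nat_mul]
      exact pow_le_pow_left₀ zero_le_two (by linarith [Real.add_one_le_exp (1 : ℝ)]) n
    _ = Real.exp (-n) := by rw [← Real.exp_add]; ring_nf

end ChungLu

end PageRankTV

namespace PageRankTV

/-! ### Non-asymptotic bound for a fixed number of vertices -/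

section Quantitative

variable {n : ℕ} {w : Fin n → ℝ} {χ : Sym2 (Fin n) → ℝ}

/-- If the centered adjacency matrix is small in the relevant directions, then PageRank is close to
the mixture. -/
theorem weightedAdj_pageRank (hpos : ∀ i, 0 < w i) (hw : ∀ i, w i ^ 2 ≤ ∑ k, w k)
    (hχ : IsLoopMask χ) (hn : 0 < n) {W : ℝ} (hW : 0 < W) (hWw : ∀ i, W ≤ w i) {ε : ℝ}
    (hε1 : ε ≤ 1 / 2) (hεW : 2 ≤ ε * W) {v x y : Fin n → ℝ}
    (hv : v ∈ stdSimplex ℝ (Fin n)) (hvxy : v = x + y) (hx : ∀ i, 0 ≤ x i) (hy : ∀ i, 0 ≤ y i)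
    {δ t : ℝ} (hyδ : ∑ i, y i ≤ δ) {ω : Sym2 (Fin n) → Bool}
    (hdeg : ∀ i, |∑ j, χ s(i, j) * (boolInd (ω s(i, j)) - chungLuProb w s(i, j))| ≤ ε / 2 * w i)
    (hl1 : ∑ i, |∑ j, χ s(i, j) * (x j / w j) * (boolInd (ω s(i, j)) - chungLuProb w s(i, j))| ≤ t)
    {α : ℝ} (hα : α ∈ Set.Ioo (0 : ℝ) 1) :
    (∀ i, 0 < degree (weightedAdj χ ω) i) ∧ (∃! π, IsPageRank (weightedAdj χ ω) α v π) ∧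
      ∀ π, IsPageRank (weightedAdj χ ω) α v π →
        tvDist π (mixture (weightedAdj χ ω) α v) ≤ 2 * δ + 3 * ε + (t + 1 / W) := by
  have : Nonempty (Fin n) := ⟨⟨0, hn⟩⟩
  have hS : 0 < ∑ k, w k := Finset.sum_pos (fun i _ => hpos i) Finset.univ_nonempty
  have hs := weightedAdj_symm (χ := χ) ω
  have h0 := weightedAdj_nonneg hχ ω
  have hε0 : 0 ≤ ε := by
    by_contra h
    nlinarith [mul_pos_of_neg_of_neg (not_le.1 h) (neg_lt_zero.2 hW)]
  have hε : ∀ i, |degree (weightedAdj χ ω) i - w i| ≤ ε * w i := fun i => by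
    have e1 : degree (weightedAdj χ ω) i - w i
        = ∑ j, χ s(i, j) * (boolInd (ω s(i, j)) - chungLuProb w s(i, j))
          + (∑ j, χ s(i, j) * chungLuProb w s(i, j) * (1 : ℝ)
            - ∑ j, chungLuProb w s(i, j) * (1 : ℝ)) := by
      simp only [mul_one, sum_chungLuProb hpos hw, degree_apply, weightedAdj, Matrix.of_apply,
        mul_sub, Finset.sum_sub_distrib]
      ring
    have h1 := abs_sum_mask_sub_le hχ (chungLuProb w) (fun _ => 1) i
    rw [abs_one] at h1
    rw [e1]
    refine (abs_add_le _ _).trans ?_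
    -- Together with `2 ≤ ε * W`, this absorbs a missing loop, which shifts the mean degree by at
    -- most `1`, into the other half of `ε * w i`.
    have h2 := mul_le_mul_of_nonneg_left (hWw i) hε0
    linarith [hdeg i]
  have hd : ∀ i, 0 < degree (weightedAdj χ ω) i := fun i => by
    have h1 := (abs_le.1 (hε i)).1
    have h2 := mul_le_mul_of_nonneg_right hε1 (hpos i).le
    linarith [hpos i]
  have hsum : ∑ i, x i + ∑ i, y i = 1 := by
    rw [← Finset.sum_add_distrib, ← hv.2, hvxy]
    rfl
  have ht : ∑ i, |(weightedAdj χ ω *ᵥ fun j => x j / w j) i - w i / (∑ k, w k) * ∑ j, x j|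
      ≤ t + 1 / W := by
    have hi : ∀ i, |(weightedAdj χ ω *ᵥ fun j => x j / w j) i - w i / (∑ k, w k) * ∑ j, x j|
        ≤ |∑ j, χ s(i, j) * (x j / w j) * (boolInd (ω s(i, j)) - chungLuProb w s(i, j))|
          + x i / W := fun i => by
      have e2 : w i / (∑ k, w k) * ∑ j, x j = ∑ j, chungLuProb w s(i, j) * (x j / w j) := by
        rw [Finset.mul_sum]
        refine Finset.sum_congr rfl fun j _ => ?_
        rw [chungLuProb_eq w hpos hw]
        have := (hpos j).ne'
        field_simp
      have e1 : (weightedAdj χ ω *ᵥ fun j => x j / w j) i - w i / (∑ k, w k) * ∑ j, x j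
          = ∑ j, χ s(i, j) * (x j / w j) * (boolInd (ω s(i, j)) - chungLuProb w s(i, j))
            + (∑ j, χ s(i, j) * chungLuProb w s(i, j) * (x j / w j)
              - ∑ j, chungLuProb w s(i, j) * (x j / w j)) := by
        rw [e2, ← add_sub_assoc, ← Finset.sum_add_distrib]
        simp only [mulVec, dotProduct, weightedAdj, Matrix.of_apply]
        congr 1
        exact Finset.sum_congr rfl fun j _ => by ring
      rw [e1]
      refine (abs_add_le _ _).trans (add_le_add le_rfl ?_)
      refine (abs_sum_mask_sub_le hχ (chungLuProb w) (fun j => x j / w j) i).trans ?_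
      rw [abs_of_nonneg (div_nonneg (hx i) (hpos i).le)]
      exact div_le_div_of_nonneg_left (hx i) hW (hWw i)
    refine (Finset.sum_le_sum fun i _ => hi i).trans ?_
    rw [Finset.sum_add_distrib, ← Finset.sum_div]
    refine add_le_add hl1 (div_le_div_of_nonneg_right ?_ hW.le)
    linarith [Finset.sum_nonneg fun i (_ : i ∈ Finset.univ) => hy i]
  refine ⟨hd, existsUnique_isPageRank hs h0 hd hα hv, fun π hπ => ?_⟩
  refine (tvDist_mixture_le hs h0 hd hα hπ).trans ?_
  have := sum_abs_transition_mulVec_sub_le hs h0 hd hpos hε hx hy hsum ht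
  rw [← hvxy] at this
  linarith

/-- The Chernoff bound for the `ℓ¹` norm needs bounded coefficients, whence the truncation of `v` at
`L / n`. The failure probability collects two degree tails per vertex and the `ℓ¹` tail. -/
theorem chungLu_pageRank (hpos : ∀ i, 0 < w i) (hw : ∀ i, w i ^ 2 ≤ ∑ k, w k)
    (hχ : IsLoopMask χ) (hn : 0 < n) {W : ℝ} (hW : 0 < W) (hWw : ∀ i, W ≤ w i) {ε : ℝ}
    (hε0 : 0 < ε) (hε1 : ε ≤ 1 / 2) (hεW : 2 ≤ ε * W) {L D : ℝ} (hL : 0 < L) {v : Fin n → ℝ}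
    (hv : v ∈ stdSimplex ℝ (Fin n)) (hvD : ∑ i, v i ^ 2 ≤ D / n) {α : ℝ}
    (hα : α ∈ Set.Ioo (0 : ℝ) 1) :
    1 - (2 * n * Real.exp (-(ε ^ 2 * W / 32)) + Real.exp (-n))
      ≤ (chungLuMeasure w).real {ω | (∀ i, 0 < degree (weightedAdj χ ω) i) ∧
        (∃! π, IsPageRank (weightedAdj χ ω) α v π) ∧
        ∀ π, IsPageRank (weightedAdj χ ω) α v π → tvDist π (mixture (weightedAdj χ ω) α v)
          ≤ 2 * (D / L) + 3 * ε + (D / L + 4 * L / W + 1 / W)} := by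
  have hn0 : (0 : ℝ) < n := Nat.cast_pos.2 hn
  set x : Fin n → ℝ := fun j => if v j ≤ L / n then v j else 0 with hxdef
  set y : Fin n → ℝ := fun j => if v j ≤ L / n then 0 else v j with hydef
  have hx : ∀ j, 0 ≤ x j := fun j => by
    simp only [hxdef]; split_ifs; exacts [hv.1 j, le_rfl]
  have hy : ∀ j, 0 ≤ y j := fun j => by
    simp only [hydef]; split_ifs; exacts [le_rfl, hv.1 j]
  have hvxy : v = x + y := by
    ext j
    simp only [hxdef, hydef, Pi.add_apply]
    split_ifs <;> simp
  have hyδ : ∑ i, y i ≤ D / L := by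
    -- Markov-type step: an entry above `L / n` is at most `n / L` times its square.
    calc ∑ i, y i ≤ ∑ i, n / L * v i ^ 2 := Finset.sum_le_sum fun i _ => by
          simp only [hydef]
          split_ifs with h
          · positivity
          · have h1 := (div_lt_iff₀ hn0).1 (not_le.1 h)
            have h2 : 1 ≤ n / L * v i := by
              rw [div_mul_eq_mul_div, le_div_iff₀ hL]
              linarith
            calc v i = 1 * v i := (one_mul _).symm
              _ ≤ n / L * v i * v i := mul_le_mul_of_nonneg_right h2 (hv.1 i)
              _ = _ := by ring
      _ = n / L * ∑ i, v i ^ 2 := (Finset.mul_sum _ _ _).symm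
      _ ≤ n / L * (D / n) := mul_le_mul_of_nonneg_left hvD (by positivity)
      _ = D / L := by field_simp
  have hxv : ∀ j, x j ≤ v j := fun j => by
    rw [hvxy]; exact le_add_of_nonneg_right (hy j)
  have hz0 : ∀ j, 0 ≤ x j / w j := fun j => div_nonneg (hx j) (hpos j).le
  have hz : ∀ j, x j / w j ≤ L / (n * W) := fun j => by
    rw [← div_div]
    refine div_le_div₀ (by positivity) ?_ hW (hWw j)
    simp only [hxdef]
    split_ifs with h
    · exact h
    · positivity
  have hz2 : ∑ j, (x j / w j) ^ 2 * w j ≤ D / (n * W) := by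
    rw [← div_div]
    calc _ ≤ ∑ j, v j ^ 2 / W := Finset.sum_le_sum fun j _ => by
          have h1 : (x j / w j) ^ 2 * w j = x j ^ 2 / w j := by
            have := (hpos j).ne'
            field_simp
          rw [h1]
          exact div_le_div₀ (sq_nonneg _) (pow_le_pow_left₀ (hx j) (hxv j) 2) hW (hWw j)
      _ = (∑ j, v j ^ 2) / W := (Finset.sum_div _ _ _).symm
      _ ≤ D / n / W := div_le_div_of_nonneg_right hvD hW.le
  set μ := bernoulliPi (chungLuProb w) with hμ
  set T : ℝ → Fin n → Set (Sym2 (Fin n) → Bool) := fun r i => {ω | ε / 2 * w i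
      ≤ r * ∑ j, χ s(i, j) * (boolInd (ω s(i, j)) - chungLuProb w s(i, j))} with hT
  set T' : Set (Sym2 (Fin n) → Bool) := {ω | D / L + 4 * L / W ≤ ∑ i, |∑ j, χ s(i, j) * (x j / w j)
      * (boolInd (ω s(i, j)) - chungLuProb w s(i, j))|} with hT'
  set G := {ω | (∀ i, 0 < degree (weightedAdj χ ω) i) ∧
        (∃! π, IsPageRank (weightedAdj χ ω) α v π) ∧
        ∀ π, IsPageRank (weightedAdj χ ω) α v π → tvDist π (mixture (weightedAdj χ ω) α v)
          ≤ 2 * (D / L) + 3 * ε + (D / L + 4 * L / W + 1 / W)} with hG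
  have hcover : Set.univ ⊆ G ∪ ((⋃ i, T 1 i) ∪ (⋃ i, T (-1) i) ∪ T') := fun ω _ => by
    by_cases h1 : ω ∈ (⋃ i, T 1 i) ∪ (⋃ i, T (-1) i) ∪ T'
    · exact Or.inr h1
    · simp only [Set.mem_union, Set.mem_iUnion, not_or, not_exists, hT, hT', Set.mem_ofPred_eq,
        not_le, one_mul, neg_mul] at h1
      refine Or.inl (weightedAdj_pageRank hpos hw hχ hn hW hWw hε1 hεW hv hvxy hx hy hyδ
        (fun i => abs_le.2 ⟨?_, (h1.1.1 i).le⟩) h1.2.le hα)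
      linarith [h1.1.2 i]
  have hTle : ∀ r : ℝ, |r| = 1 → μ.real (⋃ i, T r i) ≤ n * Real.exp (-(ε ^ 2 * W / 32)) :=
    fun r hr => by
      calc _ ≤ ∑ i, μ.real (T r i) := measureReal_iUnion_fintype_le _
        _ ≤ ∑ _i : Fin n, Real.exp (-(ε ^ 2 * W / 32)) := Finset.sum_le_sum fun i _ => by
          refine (chungLu_degree_tail hpos hw hχ hε0 (by linarith) hr i).trans
            (Real.exp_le_exp.2 ?_)
          have := mul_le_mul_of_nonneg_left (hWw i) (sq_nonneg ε)
          linarith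
        _ = _ := by simp
  have hT'le : μ.real T' ≤ Real.exp (-n) := chungLu_l1_tail hpos hw hχ hn hW hL hz0 hz hz2
  have h1 : (1 : ℝ) ≤ μ.real G + ((μ.real (⋃ i, T 1 i) + μ.real (⋃ i, T (-1) i)) + μ.real T') := by
    calc (1 : ℝ) = μ.real Set.univ := probReal_univ.symm
      _ ≤ _ := measureReal_mono hcover (measure_ne_top _ _)
      _ ≤ _ := (measureReal_union_le _ _).trans (add_le_add le_rfl
        ((measureReal_union_le _ _).trans (add_le_add (measureReal_union_le _ _) le_rfl)))
  have h2 := hTle 1 abs_one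
  have h3 := hTle (-1) (by simp)
  change _ ≤ μ.real G
  linarith

end Quantitative

end PageRankTV

namespace PageRankTV

/-! ### Choice of parameters and the limit -/

section Asymptotic

theorem sum_sq_le_of_norm_le {n : ℕ} {v : Fin n → ℝ} {C : ℝ}
    (h : ‖WithLp.toLp 2 v‖ ≤ C * ‖1 / Real.sqrt n‖) : ∑ i, v i ^ 2 ≤ C ^ 2 / n := by
  have h1 : ∑ i, v i ^ 2 = ‖WithLp.toLp 2 v‖ ^ 2 := by
    rw [EuclideanSpace.norm_sq_eq]
    simp
  rw [h1]
  refine (pow_le_pow_left₀ (norm_nonneg _) h 2).trans (le_of_eq ?_)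
  rw [mul_pow, Real.norm_eq_abs, sq_abs, div_pow, Real.sq_sqrt (Nat.cast_nonneg n)]
  ring

theorem tendsto_log_natCast_atTop : Tendsto (fun n : ℕ => Real.log n) atTop atTop :=
  Real.tendsto_log_atTop.comp tendsto_natCast_atTop_atTop

/-- The failure probability is eventually at most `3 / n`. -/
theorem failure_prob_le {n : ℕ} (hn : 0 < n) {r : ℝ} (hr : 64 * Real.log n ≤ r ^ 2) :
    2 * n * Real.exp (-(r ^ 2 / 32)) + Real.exp (-n) ≤ 3 * (n : ℝ) ^ (-1 : ℝ) := by
  have hn0 : (0 : ℝ) < n := Nat.cast_pos.2 hn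
  have h1 : Real.exp (-(r ^ 2 / 32)) ≤ (n : ℝ)⁻¹ * (n : ℝ)⁻¹ := by
    calc Real.exp (-(r ^ 2 / 32)) ≤ Real.exp (-Real.log n + -Real.log n) :=
          Real.exp_le_exp.2 (by linarith)
      _ = _ := by rw [Real.exp_add, Real.exp_neg, Real.exp_log hn0]
  have h2 : Real.exp (-(n : ℝ)) ≤ (n : ℝ)⁻¹ := by
    rw [Real.exp_neg]
    exact inv_anti₀ hn0 (by linarith [Real.add_one_le_exp (n : ℝ)])
  rw [Real.rpow_neg_one]
  calc _ ≤ 2 * n * ((n : ℝ)⁻¹ * (n : ℝ)⁻¹) + (n : ℝ)⁻¹ :=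
        add_le_add (mul_le_mul_of_nonneg_left h1 (by positivity)) h2
    _ = _ := by field_simp; norm_num

theorem chungLu_pageRankApproxWHP {α : ℝ} (hα : α ∈ Set.Ioo (0 : ℝ) 1)
    {v : ∀ n : ℕ, Fin n → ℝ} (hv : ∀ n : ℕ, 0 < n → v n ∈ stdSimplex ℝ (Fin n))
    (hvO : (fun n : ℕ => ‖WithLp.toLp 2 (v n)‖) =O[atTop] (fun n : ℕ => 1 / Real.sqrt (n : ℝ)))
    {K : ℝ} {w : ∀ n : ℕ, Fin n → ℝ} (hpos : ∀ n i, 0 < w n i)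
    (hw : ∀ n i, w n i ^ 2 ≤ ∑ k, w n k) (hK : ∀ n i j, w n i ≤ K * w n j)
    (hlog : (fun n : ℕ => Real.log (n : ℝ) ^ 6) =o[atTop]
      (fun n : ℕ => (∑ k, w n k) / (n : ℝ)))
    {χ : ∀ n, Sym2 (Fin n) → ℝ} (hχ : ∀ n, IsLoopMask (χ n)) :
    PageRankApproxWHP (fun n => chungLuMeasure (w n)) (fun n => weightedAdj (χ n)) α v := by
  have hK0 : 0 < K := by
    have h1 := hpos 1 0
    exact pos_of_mul_pos_left (h1.trans_le (hK 1 0 0)) h1.le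
  obtain ⟨C, hC⟩ := hvO.bound
  -- The mean weight divided by `K` is a lower bound for every weight.
  set W : ℕ → ℝ := fun n => (∑ k, w n k) / n / K with hW
  have hWnn : ∀ n, 0 ≤ W n := fun n => by
    have : 0 ≤ ∑ k, w n k := Finset.sum_nonneg fun i _ => (hpos n i).le
    positivity
  have hWw : ∀ n i, W n ≤ w n i := fun n i => by
    have hn : (0 : ℝ) < n := Nat.cast_pos.2 i.pos
    rw [hW, div_le_iff₀ hK0, div_le_iff₀ hn]
    calc ∑ k, w n k ≤ ∑ _k : Fin n, K * w n i := Finset.sum_le_sum fun k _ => hK n k i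
      _ = _ := by simp; ring
  have hWlog : ∀ᶠ n : ℕ in atTop, Real.log n ^ 6 ≤ W n := by
    filter_upwards [hlog.bound (inv_pos.2 hK0)] with n hn
    refine (le_abs_self _).trans (hn.trans (le_of_eq ?_))
    rw [Real.norm_of_nonneg (div_nonneg (Finset.sum_nonneg fun i _ => (hpos n i).le)
      (Nat.cast_nonneg n)), hW, inv_mul_eq_div]
  have hWtop : Tendsto W atTop atTop := tendsto_atTop_mono' _ hWlog
    ((tendsto_pow_atTop (by norm_num)).comp tendsto_log_natCast_atTop)
  set r : ℕ → ℝ := fun n => Real.sqrt (Real.sqrt (W n)) with hr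
  have hr2 : ∀ n, r n ^ 2 = Real.sqrt (W n) := fun n => Real.sq_sqrt (Real.sqrt_nonneg _)
  have hr4 : ∀ n, W n = r n ^ 4 := fun n => by
    rw [show r n ^ 4 = (r n ^ 2) ^ 2 by ring, hr2, Real.sq_sqrt (hWnn n)]
  have hrtop : Tendsto r atTop atTop :=
    Real.tendsto_sqrt_atTop.comp (Real.tendsto_sqrt_atTop.comp hWtop)
  -- Parameters: `W = r ^ 4`, `ε = 1 / r`, `L = r ^ 2`, `D = C ^ 2`. Then `L / W` and `D / L` are of
  -- order `r ^ (-2)`, while `ε ^ 2 * W = r ^ 2` still dominates `log n`.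
  refine ⟨fun n => 2 * (C ^ 2 / r n ^ 2) + 3 * (1 / r n)
    + (C ^ 2 / r n ^ 2 + 4 * r n ^ 2 / W n + 1 / W n), ?_, 1, one_pos, 3, ?_⟩
  · have hpow : ∀ (c : ℝ) (k : ℕ), k ≠ 0 → Tendsto (fun n => c / r n ^ k) atTop (𝓝 0) :=
      fun c k hk => ((tendsto_pow_atTop hk).comp hrtop).const_div_atTop c
    have h := (((hpow (C ^ 2) 2 two_ne_zero).const_mul 2).add
      ((hpow 1 1 one_ne_zero).const_mul 3)).add
      (((hpow (C ^ 2) 2 two_ne_zero).add (hpow 4 2 two_ne_zero)).add (hpow 1 4 four_ne_zero))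
    simp only [mul_zero, add_zero] at h
    refine h.congr' ?_
    filter_upwards [hrtop.eventually_gt_atTop 0] with n hn
    rw [hr4 n, pow_one]
    have : 4 / r n ^ 2 = 4 * r n ^ 2 / r n ^ 4 := by field_simp
    rw [this]
  · have hev : ∀ᶠ n : ℕ in atTop, 0 < n ∧ 2 ≤ r n ∧ 64 * Real.log n ≤ r n ^ 2 ∧
        ‖WithLp.toLp 2 (v n)‖ ≤ C * ‖1 / Real.sqrt n‖ := by
      filter_upwards [eventually_gt_atTop 0, hrtop.eventually_ge_atTop 2, hC, hWlog,
        tendsto_log_natCast_atTop.eventually_ge_atTop 8] with n h1 h2 h3 h4 h5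
      refine ⟨h1, h2, ?_, (norm_norm _).symm.trans_le h3⟩
      rw [hr2]
      refine Real.le_sqrt_of_sq_le (le_trans ?_ h4)
      -- Since `64 ^ 2 = 8 ^ 4`, having `log n ≥ 8` gives `(64 log n) ^ 2 ≤ log n ^ 6 ≤ W`.
      have h6 : (8 : ℝ) ^ 4 ≤ Real.log n ^ 4 := pow_le_pow_left₀ (by norm_num) h5 4
      have h7 := mul_le_mul_of_nonneg_left h6 (sq_nonneg (Real.log n))
      calc (64 * Real.log n) ^ 2 = Real.log n ^ 2 * 8 ^ 4 := by ring
        _ ≤ _ := h7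
        _ = _ := by ring
    obtain ⟨N, hN⟩ := eventually_atTop.1 hev
    refine ⟨N, fun n hn => ?_⟩
    obtain ⟨hn0, hr2le, hrlog, hvn⟩ := hN n hn.le
    have hrpos : 0 < r n := by linarith
    have hWpos : 0 < W n := by rw [hr4]; positivity
    have hεW : 2 ≤ 1 / r n * W n := by
      have : 1 / r n * W n = r n ^ 3 := by rw [hr4]; field_simp
      rw [this]
      linarith [pow_le_pow_left₀ zero_le_two hr2le 3]
    have h := chungLu_pageRank (hpos n) (hw n) (hχ n) hn0 hWpos (hWw n) (one_div_pos.2 hrpos)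
      (one_div_le_one_div_of_le two_pos hr2le) hεW (pow_pos hrpos 2) (hv n hn0)
      (sum_sq_le_of_norm_le hvn) hα
    refine le_trans ?_ h
    have he : (1 / r n) ^ 2 * W n / 32 = r n ^ 2 / 32 := by rw [hr4]; field_simp
    rw [he]
    linarith [failure_prob_le hn0 hrlog]

theorem isLoopMask_one (n : ℕ) : IsLoopMask fun _ : Sym2 (Fin n) => (1 : ℝ) :=
  ⟨fun _ => Or.inr rfl, fun _ _ _ => rfl⟩

theorem isLoopMask_ite_isDiag (n : ℕ) :
    IsLoopMask fun e : Sym2 (Fin n) => if e.IsDiag then (0 : ℝ) else 1 :=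
  ⟨fun e => by split_ifs <;> simp, fun i j hij => by simp [hij]⟩

theorem weightedAdj_one (n : ℕ) :
    weightedAdj (fun _ : Sym2 (Fin n) => (1 : ℝ)) = adjLoops := by
  ext ω i j
  simp [weightedAdj, adjLoops, boolInd]

theorem weightedAdj_ite_isDiag (n : ℕ) :
    weightedAdj (fun e : Sym2 (Fin n) => if e.IsDiag then (0 : ℝ) else 1) = adjSimple := by
  ext ω i j
  by_cases h : i = j <;> simp [weightedAdj, adjSimple, boolInd, h]

end Asymptotic

/-! ### Erdős–Rényi graphs as Chung–Lu graphs with constant weights -/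

section ErdosRenyi

/-- The simple graph with edge indicators `ω`. -/
def graphOfIndicator {n : ℕ} (ω : Sym2 (Fin n) → Bool) : SimpleGraph (Fin n) :=
  SimpleGraph.fromEdgeSet {e | ω e = true}

theorem adjGraph_graphOfIndicator {n : ℕ} (ω : Sym2 (Fin n) → Bool) :
    adjGraph (graphOfIndicator ω) = adjSimple ω := by
  ext i j
  have h : (graphOfIndicator ω).Adj i j ↔ i ≠ j ∧ ω s(i, j) = true := by
    simp [graphOfIndicator, and_comm]
  simp only [adjGraph, adjSimple, SimpleGraph.adjMatrix_apply, Matrix.of_apply, h]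

/-- The binomial random graph has independent edge indicators. -/
theorem binomialRandom_eq_map_graphOfIndicator (n : ℕ) (p : I) :
    SimpleGraph.binomialRandom (Fin n) p
      = (bernoulliPi fun _ : Sym2 (Fin n) => p).map graphOfIndicator := by
  set u : Set (Sym2 (Fin n)) := Sym2.diagSetᶜ with hu
  have h1 : (Measure.infinitePi fun e : Sym2 (Fin n) =>
      unitInterval.toNNReal p • Measure.dirac (e ∈ u)
        + unitInterval.toNNReal (unitInterval.symm p) • Measure.dirac False)
      = (bernoulliPi fun _ : Sym2 (Fin n) => p).map
        fun ω e => (ω e = true ∧ e ∈ u) := by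
    have h2 : ∀ e : Sym2 (Fin n), unitInterval.toNNReal p • Measure.dirac (e ∈ u)
        + unitInterval.toNNReal (unitInterval.symm p) • Measure.dirac False
        = (bernoulliMeasure true false p).map fun b => (b = true ∧ e ∈ u) := fun e => by
      rw [map_bernoulliMeasure, bernoulliMeasure_def]
      simp
    simp only [h2]
    have (e : Sym2 (Fin n)) : IsProbabilityMeasure
        ((bernoulliMeasure true false p).map fun b => (b = true ∧ e ∈ u)) :=
      Measure.isProbabilityMeasure_map (by fun_prop)
    rw [Measure.infinitePi_eq_pi]
    exact (Measure.pi_map_pi fun e => by fun_prop).symm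
  rw [SimpleGraph.binomialRandom_eq_map, setBernoulli_eq_map, h1,
    Measure.map_map (by fun_prop) (by fun_prop), Measure.map_map (by fun_prop) (by fun_prop)]
  congr 1
  ext ω i j
  simp [graphOfIndicator, hu]

theorem chungLuProb_const {n : ℕ} {p : I} (hn : 0 < n) (hp : 0 < (p : ℝ)) :
    chungLuProb (fun _ : Fin n => (n : ℝ) * p) = fun _ => p := by
  have hn0 : (0 : ℝ) < n := Nat.cast_pos.2 hn
  ext e
  induction e using Sym2.ind with
  | _ i j =>
    rw [chungLuProb_eq _ (fun _ => mul_pos hn0 hp)]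
    · simp only [Finset.sum_const, Finset.card_univ, Fintype.card_fin, nsmul_eq_mul]
      field_simp
    · intro _
      simp only [Finset.sum_const, Finset.card_univ, Fintype.card_fin, nsmul_eq_mul]
      have h1 := mul_le_of_le_one_left hp.le p.2.2
      have h2 := mul_le_mul_of_nonneg_left h1 (mul_nonneg hn0.le hn0.le)
      linarith

theorem erdosRenyi_pageRankApproxWHP {α : ℝ} (hα : α ∈ Set.Ioo (0 : ℝ) 1)
    {v : ∀ n : ℕ, Fin n → ℝ} (hv : ∀ n : ℕ, 0 < n → v n ∈ stdSimplex ℝ (Fin n))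
    (hvO : (fun n : ℕ => ‖WithLp.toLp 2 (v n)‖) =O[atTop] (fun n : ℕ => 1 / Real.sqrt (n : ℝ)))
    {p : ℕ → I}
    (hlog : (fun n : ℕ => Real.log (n : ℝ) ^ 6) =o[atTop] (fun n : ℕ => (n : ℝ) * (p n : ℝ))) :
    PageRankApproxWHP (fun n => SimpleGraph.binomialRandom (Fin n) (p n)) (fun _ => adjGraph)
      α v := by
  -- The value `1` keeps the weights positive at the finitely many `n` where `p n` may vanish.
  set w : ∀ n : ℕ, Fin n → ℝ := fun n _ => if 0 < (p n : ℝ) then n * p n else 1 with hw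
  have hwn : ∀ n, 0 < (p n : ℝ) → w n = fun _ => (n : ℝ) * p n := fun n h =>
    funext fun _ => if_pos h
  have hppos : ∀ᶠ n : ℕ in atTop, 0 < (p n : ℝ) := by
    filter_upwards [hlog.bound one_pos, tendsto_log_natCast_atTop.eventually_gt_atTop 0]
      with n h1 h2
    refine lt_of_le_of_ne (p n).2.1 fun h => ?_
    rw [← h, mul_zero, norm_zero, mul_zero] at h1
    exact (norm_pos_iff.2 (pow_pos h2 6).ne').not_ge h1
  have hwpos : ∀ n i, 0 < w n i := fun n i => by
    have hn : (0 : ℝ) < n := Nat.cast_pos.2 i.pos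
    simp only [hw]
    split_ifs with h
    · exact mul_pos hn h
    · exact one_pos
  have hwsq : ∀ n i, w n i ^ 2 ≤ ∑ k, w n k := fun n i => by
    have hn : (1 : ℝ) ≤ n := Nat.one_le_cast.2 i.pos
    have h1 : w n i ≤ n := by
      simp only [hw]
      split_ifs with h
      · exact mul_le_of_le_one_right (by linarith) (p n).2.2
      · exact hn
    have h2 : ∑ k, w n k = n * w n i := by simp [hw]
    rw [h2, sq]
    exact mul_le_mul_of_nonneg_right h1 (hwpos n i).le
  have hwlog : (fun n : ℕ => Real.log (n : ℝ) ^ 6) =o[atTop]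
      (fun n : ℕ => (∑ k, w n k) / (n : ℝ)) := by
    refine hlog.congr' EventuallyEq.rfl ?_
    filter_upwards [hppos, eventually_gt_atTop 0] with n h1 h2
    have hn : (n : ℝ) ≠ 0 := Nat.cast_ne_zero.2 h2.ne'
    simp only [hwn n h1, Finset.sum_const, Finset.card_univ, Fintype.card_fin, nsmul_eq_mul]
    field_simp
  obtain ⟨ψ, hψ, c, hc, C, N, hN⟩ := chungLu_pageRankApproxWHP hα hv hvO hwpos hwsq (K := 1)
    (fun n i j => by simp [hw]) hwlog isLoopMask_ite_isDiag
  obtain ⟨N', hN'⟩ := eventually_atTop.1 hppos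
  refine ⟨ψ, hψ, c, hc, C, max N N', fun n hn => ?_⟩
  refine (hN n ((le_max_left _ _).trans_lt hn)).trans ?_
  have hp := hN' n ((le_max_right _ _).trans hn.le)
  have hμ : chungLuMeasure (w n) = bernoulliPi fun _ : Sym2 (Fin n) => p n := by
    rw [hwn n hp, chungLuMeasure, chungLuProb_const (Nat.zero_lt_of_lt hn) hp]
  beta_reduce
  rw [hμ, binomialRandom_eq_map_graphOfIndicator, weightedAdj_ite_isDiag]
  simp only [← adjGraph_graphOfIndicator]
  have := Measure.isProbabilityMeasure_map (μ := bernoulliPi fun _ : Sym2 (Fin n) => p n)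
    (f := graphOfIndicator) (Measurable.of_discrete).aemeasurable
  -- The inequality between the measure of a preimage and the pushforward holds for arbitrary sets,
  -- so the event on graphs need not be shown measurable.
  exact ENNReal.toReal_mono (measure_ne_top _ _)
    (Measure.le_map_apply (Measurable.of_discrete).aemeasurable _)

end ErdosRenyi

end PageRankTV

theorem mainTheorem4 (α : ℝ) (hα : α ∈ Set.Ioo (0 : ℝ) 1)
    (v : ∀ n : ℕ, Fin n → ℝ) (hv : ∀ n : ℕ, 0 < n → v n ∈ stdSimplex ℝ (Fin n))
    (hvO : (fun n : ℕ => ‖WithLp.toLp 2 (v n)‖) =O[atTop] (fun n : ℕ => 1 / Real.sqrt (n : ℝ))) :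
    -- Chung-Lu graphs, with loops and without
    (∀ (K : ℝ) (w : ∀ n : ℕ, Fin n → ℝ),
      (∀ n i, 0 < w n i) →
      (∀ n i, w n i ^ 2 ≤ ∑ k, w n k) →
      (∀ n i j, w n i ≤ K * w n j) →
      (fun n : ℕ => Real.log (n : ℝ) ^ 6) =o[atTop] (fun n : ℕ => (∑ k, w n k) / (n : ℝ)) →
      PageRankTV.PageRankApproxWHP (fun n => PageRankTV.chungLuMeasure (w n))
          (fun _ => PageRankTV.adjLoops) α v ∧
        PageRankTV.PageRankApproxWHP (fun n => PageRankTV.chungLuMeasure (w n))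
          (fun _ => PageRankTV.adjSimple) α v) ∧
    -- Erdős-Rényi graphs
    (∀ p : ℕ → unitInterval,
      (fun n : ℕ => Real.log (n : ℝ) ^ 6) =o[atTop] (fun n : ℕ => (n : ℝ) * (p n : ℝ)) →
      PageRankTV.PageRankApproxWHP
        (fun n => SimpleGraph.binomialRandom (Fin n) (p n))
        (fun _ => PageRankTV.adjGraph) α v) := by
  refine ⟨fun K w hpos hw hK hlog => ⟨?_, ?_⟩, fun p hp =>
    PageRankTV.erdosRenyi_pageRankApproxWHP hα hv hvO hp⟩
  · have h := PageRankTV.chungLu_pageRankApproxWHP hα hv hvO hpos hw hK hlog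
      PageRankTV.isLoopMask_one
    simpa only [PageRankTV.weightedAdj_one] using h
  · have h := PageRankTV.chungLu_pageRankApproxWHP hα hv hvO hpos hw hK hlog
      PageRankTV.isLoopMask_ite_isDiag
    simpa only [PageRankTV.weightedAdj_ite_isDiag] using h
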